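/- Let $\Bbbk$ be a field and let $\mathsf{IT}(\mathbb{R})$ be Igusa and Todorov's category: the full subcategory of the category of functors $M$ from the poset $\mathbb{R}$ to finite-dimensional $\Bbbk$-vector spaces such that (IT1) for every $x\in\mathbb{R}$ the canonical map $M(x)\to\lim_{y>x}M(y)$ is an isomorphism, and (IT2) for all but finitely many $x\in\mathbb{R}$ there is an $\varepsilon>0$ such that $M(y)\to M(z)$ is an isomorphism whenever $x-\varepsilon<y\le z<x+\varepsilon$. This is an abelian category. For an object $X$ of an abelian category $\mathcal{A}$, a *pre-subobject chain* of $X$ is a set $\Delta$ of subobjects of $X$ that is totally ordered by inclusion. Regard $\Delta$ as a diagram in $\mathcal{A}$, whose morphisms are the inclusions; $\operatorname{colim}\Delta$ and, for $\Delta\neq\emptyset$, $\lim\Delta$ denote its colimit and limit in $\mathcal{A}$. The object $X$ is *weakly Jordan–Hölder–Schreier* (weakly JHS) if 1. for every pre-subobject chain $\Delta$ of $X$ the colimit $\operatorname{colim}\Delta$ exists and its induced map to $X$ is a monomorphism, and $\operatorname{colim}\{Y\cap Z\mid Y\in\Delta\}=(\operatorname{colim}\Delta)\cap Z$ for every subobject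 $Z$ of $X$; 2. for every nonempty pre-subobject chain $\Delta$ of $X$ the limit $\lim\Delta$ exists, and $\lim\{Y+Z\mid Y\in\Delta\}=(\lim\Delta)+Z$ for every subobject $Z$ of $X$. A *composition series* of $X$ is a pre-subobject chain $\Delta$ containing $0$ and $X$ such that for each subset $\Delta'\subseteq\Delta$ the colimit of $\Delta'$, and the limit of $\Delta'$ if $\Delta'\neq\emptyset$, exists and is a member of $\Delta$, and such that every *subfactor* of $\Delta$, that is, every quotient $Y/Y^-$ with $Y\in\Delta$, $Y^-:=\operatorname{colim}\{Z\in\Delta\mid Z\subsetneq Y\}$ and $Y^-\ne Y$, is simple. The object $X$ is *Jordan–Hölder–Schreier* (JHS) if it is weakly JHS and, in case $X\neq0$, every composition series of $X$ has at least one subfactor. **Proposition.** Every object of $\mathsf{IT}(\mathbb{R})$ is weakly JHS in $\mathsf{IT}(\mathbb{R})$. The category $\mathsf{IT}(\mathbb{R})$ has no simple objects, and no nonzero object of $\mathsf{IT}(\mathbb{R})$ is JHS in $\mathsf{IT}(\mathbb{R})$. -/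

import Mathlib

open CategoryTheory CategoryTheory.Limits

universe v w u

noncomputable section

namespace JHS

section Chains

variable {A : Type u} [Category.{v} A]

/-- The diagram in the ambient category `A` given by a set `Δ` of subobjects of `X`: its objects are
the underlying objects of the members of `Δ`, its morphisms are the inclusions between them. -/
def chainDiagram {X : A} (Δ : Set (Subobject X)) : Δ ⥤ A where
  obj Y := (Y.1 : A)
  map {Y Z} f := Subobject.ofLE Y.1 Z.1 (leOfHom f)

/-- A subobject `C` containing every member of `Δ` is the vertex of a cocone on the diagram. -/
def chainCocone {X : A} (Δ : Set (Subobject X)) (C : Subobject X) (h : ∀ Y ∈ Δ, Y ≤ C) :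
    Cocone (chainDiagram Δ) where
  pt := (C : A)
  ι :=
    { app := fun Y => Subobject.ofLE Y.1 C (h Y.1 Y.2)
      naturality := fun Y Z f => by simp [chainDiagram] }

/-- A subobject `L` contained in every member of `Δ` is the vertex of a cone on the diagram. -/
def chainCone {X : A} (Δ : Set (Subobject X)) (L : Subobject X) (h : ∀ Y ∈ Δ, L ≤ Y) :
    Cone (chainDiagram Δ) where
  pt := (L : A)
  π :=
    { app := fun Y => Subobject.ofLE L Y.1 (h Y.1 Y.2)
      naturality := fun Y Z f => by simp [chainDiagram] }

/-- "`colim Δ` exists (in the ambient category), is a subobject of `X`, and equals `C`". -/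
def IsChainColimit {X : A} (Δ : Set (Subobject X)) (C : Subobject X) : Prop :=
  ∃ h : ∀ Y ∈ Δ, Y ≤ C, Nonempty (IsColimit (chainCocone Δ C h))

/-- "`lim Δ` exists (in the ambient category) and equals the subobject `L` of `X`". This is only
used for nonempty `Δ`; the limit of such a chain, if it exists, is automatically a subobject. -/
def IsChainLimit {X : A} (Δ : Set (Subobject X)) (L : Subobject X) : Prop :=
  ∃ h : ∀ Y ∈ Δ, L ≤ Y, Nonempty (IsLimit (chainCone Δ L h))

/-- Pre-subobject chains: sets of subobjects that are totally ordered by inclusion. -/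
def IsPreSubobjectChain {X : A} (Δ : Set (Subobject X)) : Prop :=
  IsChain (· ≤ ·) Δ

/-- Every pre-subobject chain of `X` has a colimit in the ambient category, which is a subobject
of `X`. -/
def SubobjectCocomplete (X : A) : Prop :=
  ∀ Δ : Set (Subobject X), IsPreSubobjectChain Δ → ∃ C, IsChainColimit Δ C

/-- Every (nonempty) pre-subobject chain of `X` has a limit in the ambient category. -/
def SubobjectComplete (X : A) : Prop :=
  ∀ Δ : Set (Subobject X), IsPreSubobjectChain Δ → Δ.Nonempty → ∃ L, IsChainLimit Δ L

end Chains

section Abelian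

variable {A : Type u} [Category.{v} A] [Abelian A]

/-- Weakly Jordan–Hölder–Schreier objects. In the first axiom, `colim (Δ ∩ Z) = (colim Δ) ∩ Z`
with `Δ ∩ Z = {Y ∩ Z | Y ∈ Δ}`; in the second, `lim (Δ + Z) = (lim Δ) + Z` with
`Δ + Z = {Y + Z | Y ∈ Δ}`. -/
structure IsWeaklyJHS (X : A) : Prop where
  cocomplete : SubobjectCocomplete X
  colim_inter : ∀ (Δ : Set (Subobject X)) (Z C : Subobject X), IsPreSubobjectChain Δ →
    IsChainColimit Δ C → IsChainColimit ((fun Y => Y ⊓ Z) '' Δ) (C ⊓ Z)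
  complete : SubobjectComplete X
  lim_add : ∀ (Δ : Set (Subobject X)) (Z L : Subobject X), IsPreSubobjectChain Δ → Δ.Nonempty →
    IsChainLimit Δ L → IsChainLimit ((fun Y => Y ⊔ Z) '' Δ) (L ⊔ Z)

/-- Bicomplete subobject chains: totally ordered sets of subobjects which contain `0` and `X` and
the colimits and limits of all of their subsets. (The colimit of the empty subset is `0`; for the
limit, only nonempty subsets matter.) -/
structure IsBicompleteChain {X : A} (Δ : Set (Subobject X)) : Prop where
  chain : IsPreSubobjectChain Δ
  bot_mem : ⊥ ∈ Δ
  top_mem : ⊤ ∈ Δ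
  cocomplete : ∀ Δ' ⊆ Δ, ∃ C ∈ Δ, IsChainColimit Δ' C
  complete : ∀ Δ' ⊆ Δ, Δ'.Nonempty → ∃ L ∈ Δ, IsChainLimit Δ' L

/-- `P = Y⁻`, the colimit of the members of `Δ` strictly contained in `Y`. For `Y = 0` this is the
colimit of the empty diagram, that is, `0`. -/
def IsPred {X : A} (Δ : Set (Subobject X)) (Y P : Subobject X) : Prop :=
  IsChainColimit {Z | Z ∈ Δ ∧ Z < Y} P

/-- The index set of the subfactor multiset of `Δ`: the pairs `(Y⁻, Y)` with `Y ∈ Δ` and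
`Y⁻ ≠ Y`. -/
def SubfactorIndex {X : A} (Δ : Set (Subobject X)) : Type max u v :=
  {p : Subobject X × Subobject X // p.2 ∈ Δ ∧ IsPred Δ p.2 p.1 ∧ p.1 < p.2}

/-- The subfactor multiset of `Δ`, as the family of objects `Y / Y⁻`. -/
def sf {X : A} (Δ : Set (Subobject X)) (p : SubfactorIndex Δ) : A :=
  cokernel (Subobject.ofLE p.1.1 p.1.2 p.2.2.2.le)

/-- Composition series: bicomplete subobject chains all of whose subfactors are simple. -/
structure IsCompositionSeries {X : A} (Δ : Set (Subobject X)) : Prop where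
  bicomplete : IsBicompleteChain Δ
  simple : ∀ p : SubfactorIndex Δ, Simple (sf Δ p)

/-- Jordan–Hölder–Schreier objects: weakly JHS objects `X` such that, if `X ≠ 0`, every composition
series of `X` has at least one subfactor. -/
structure IsJHS (X : A) : Prop extends IsWeaklyJHS X where
  sf_nonempty : ¬ IsZero X → ∀ Δ : Set (Subobject X), IsCompositionSeries Δ →
    Nonempty (SubfactorIndex Δ)

end Abelian

/-! ### The category of Igusa and Todorov -/

section IT

variable {D : Type u} [Category.{v} D]

/-- The objects `M(y)`, `y > x`, of a functor `M` on `ℝ`, with the maps between them. -/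
def rightDiagram (M : ℝ ⥤ D) (x : ℝ) : Set.Ioi x ⥤ D where
  obj y := M.obj y.1
  map f := M.map (homOfLE (leOfHom f))
  map_id y := M.map_id _
  map_comp f g := by rw [← M.map_comp]; rfl

/-- The structure maps `M(x) ⟶ M(y)`, `y > x`, as a cone with vertex `M(x)`. -/
def rightCone (M : ℝ ⥤ D) (x : ℝ) : Cone (rightDiagram M x) where
  pt := M.obj x
  π :=
    { app := fun y => M.map (homOfLE (le_of_lt y.2))
      naturality := fun y z f => by
        simp [rightDiagram, ← M.map_comp] }

/-- Right continuity at `x`: the canonical map `M(x) ⟶ lim_{y > x} M(y)` is an isomorphism. -/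
def IsRightContinuousAt (M : ℝ ⥤ D) (x : ℝ) : Prop :=
  Nonempty (IsLimit (rightCone M x))

/-- `M` is locally constant at `x`: for some `ε > 0` all the structure maps of `M` inside the
interval `(x - ε, x + ε)` are isomorphisms. -/
def IsLocallyConstantAt (M : ℝ ⥤ D) (x : ℝ) : Prop :=
  ∃ ε > 0, ∀ (y z : ℝ) (h : y ≤ z), x - ε < y → z < x + ε → IsIso (M.map (homOfLE h))

/-- The objects of Igusa and Todorov's category: functors that are right continuous everywhere and
locally constant at all but finitely many points. -/
def isIT (D : Type u) [Category.{v} D] : ObjectProperty (ℝ ⥤ D) := fun M =>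
  (∀ x, IsRightContinuousAt M x) ∧ {x | ¬ IsLocallyConstantAt M x}.Finite

/-- `M` is constant on a small interval `[x, x + ε)`. -/
def IsRightConstantAt (M : ℝ ⥤ D) (x : ℝ) : Prop :=
  ∃ ε > 0, ∀ (y : ℝ) (h : x ≤ y), y < x + ε → IsIso (M.map (homOfLE h))

lemma map_homOfLE_comp (M : ℝ ⥤ D) {u v w : ℝ} (h : u ≤ v) (h' : v ≤ w) :
    M.map (homOfLE h) ≫ M.map (homOfLE h') = M.map (homOfLE (h.trans h')) := by
  rw [← M.map_comp]; rfl

lemma isRightContinuousAt_of_isRightConstantAt {M : ℝ ⥤ D} {x : ℝ} (h : IsRightConstantAt M x) :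
    IsRightContinuousAt M x := by
  obtain ⟨ε, hε, h⟩ := h
  have hx : x < x + ε / 2 := by linarith
  have hi : IsIso (M.map (homOfLE hx.le)) := h _ _ (by linarith)
  have key : ∀ (W : D) (φ : ∀ y : ℝ, x < y → (W ⟶ M.obj y))
      (_ : ∀ (y z : ℝ) (hy : x < y) (hz : x < z) (hyz : y ≤ z),
        φ y hy ≫ M.map (homOfLE hyz) = φ z hz) (y : ℝ) (hy : x < y),
      (φ _ hx ≫ inv (M.map (homOfLE hx.le))) ≫ M.map (homOfLE hy.le) = φ y hy := by
    intro W φ hφ y hy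
    have hm : x < min y (x + ε / 2) := lt_min hy hx
    have := h _ hm.le (lt_of_le_of_lt (min_le_right _ _) (by linarith))
    have f3 : M.map (homOfLE (min_le_right y (x + ε / 2))) ≫ inv (M.map (homOfLE hx.le)) ≫
        M.map (homOfLE hm.le) = 𝟙 _ := by
      rw [← cancel_epi (M.map (homOfLE hm.le)), ← Category.assoc, map_homOfLE_comp]
      simp
    rw [← hφ _ _ hm hy (min_le_left _ _), ← hφ _ _ hm hx (min_le_right _ _),
      ← map_homOfLE_comp M hm.le (min_le_left _ _)]
    simp only [Category.assoc]
    rw [reassoc_of% f3]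
  have key' (s : Cone (rightDiagram M x)) (y : Set.Ioi x) :=
    key s.pt (fun y hy => s.π.app ⟨y, hy⟩)
      (fun y z hy hz hyz => s.w (j := ⟨y, hy⟩) (j' := ⟨z, hz⟩) (homOfLE hyz)) y.1 y.2
  let r : M.obj (x + ε / 2) ⟶ M.obj x := inv (M.map (homOfLE hx.le))
  refine ⟨{ lift := fun s => s.π.app ⟨x + ε / 2, hx⟩ ≫ r,
            fac := key', uniq := ?_ }⟩
  intro s m hm
  exact (cancel_mono (M.map (homOfLE hx.le))).1
    ((hm ⟨x + ε / 2, hx⟩).trans (key' s ⟨x + ε / 2, hx⟩).symm)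

lemma isIso_map_of_locallyConstant {M : ℝ ⥤ D} {a b : ℝ}
    (h : ∀ x ∈ Set.Ioo a b, IsLocallyConstantAt M x) {y z : ℝ} (hyz : y ≤ z) (hy : a < y)
    (hz : z < b) : IsIso (M.map (homOfLE hyz)) := by
  let R : ℝ → ℝ → Prop := fun u v => (∀ h : u ≤ v, IsIso (M.map (homOfLE h))) ∧
    (∀ h : v ≤ u, IsIso (M.map (homOfLE h)))
  have comp : ∀ {u v w : ℝ} (h : u ≤ v) (h' : v ≤ w),
      M.map (homOfLE (h.trans h')) = M.map (homOfLE h) ≫ M.map (homOfLE h') := by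
    intro u v w h h'
    rw [← M.map_comp]; rfl
  have c1 : ∀ {u v w : ℝ} (h : u ≤ v) (h' : v ≤ w), IsIso (M.map (homOfLE h)) →
      IsIso (M.map (homOfLE h')) → IsIso (M.map (homOfLE (h.trans h'))) := by
    intro u v w h h' i i'
    rw [comp h h']; infer_instance
  have c2 : ∀ {u v w : ℝ} (h : u ≤ v) (h' : v ≤ w), IsIso (M.map (homOfLE h)) →
      IsIso (M.map (homOfLE (h.trans h'))) → IsIso (M.map (homOfLE h')) := by
    intro u v w h h' i i'
    rw [comp h h'] at i'
    exact IsIso.of_isIso_comp_left (M.map (homOfLE h)) _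
  have c3 : ∀ {u v w : ℝ} (h : u ≤ v) (h' : v ≤ w), IsIso (M.map (homOfLE h')) →
      IsIso (M.map (homOfLE (h.trans h'))) → IsIso (M.map (homOfLE h)) := by
    intro u v w h h' i i'
    rw [comp h h'] at i'
    exact IsIso.of_isIso_comp_right _ (M.map (homOfLE h'))
  have tr1 : ∀ u v w : ℝ, R u v → R v w → ∀ h : u ≤ w, IsIso (M.map (homOfLE h)) := by
    intro u v w h1 h2 h
    rcases le_total u v with huv | huv
    · rcases le_total v w with hvw | hvw
      · exact c1 huv hvw (h1.1 huv) (h2.1 hvw)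
      · exact c3 h hvw (h2.2 hvw) (h1.1 huv)
    · exact c2 huv h (h1.2 huv) (h2.1 (huv.trans h))
  have sym : ∀ u v, R u v → R v u := fun u v h => ⟨h.2, h.1⟩
  have : R y z := by
    refine isPreconnected_Ioo.induction₂ R (s := Set.Ioo a b) ?_ ?_ ?_
      ⟨hy, hyz.trans_lt hz⟩ ⟨hy.trans_le hyz, hz⟩
    · intro x hx
      obtain ⟨ε, hε, H⟩ := h x hx
      have : Set.Ioo (x - ε) (x + ε) ∈ nhdsWithin x (Set.Ioo a b) :=
        mem_nhdsWithin_of_mem_nhds (Ioo_mem_nhds (by linarith) (by linarith))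
      filter_upwards [this] with t ht
      exact ⟨fun h => H _ _ h (by linarith) ht.2, fun h => H _ _ h ht.1 (by linarith)⟩
    · intro u v w _ _ _ h1 h2
      exact ⟨tr1 u v w h1 h2, tr1 w v u (sym _ _ h2) (sym _ _ h1)⟩
    · intro u v _ _ h
      exact sym _ _ h
  exact this.1 hyz

lemma isRightConstantAt_of_isIT {M : ℝ ⥤ D} (hM : isIT D M) (x : ℝ) : IsRightConstantAt M x := by
  obtain ⟨⟨hl⟩, hF⟩ := And.intro (hM.1 x) hM.2
  have hev : ∀ᶠ t in nhdsWithin x (Set.Ioi x), t ∉ {x | ¬ IsLocallyConstantAt M x} \ {x} := by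
    have hc : IsClosed ({x | ¬ IsLocallyConstantAt M x} \ {x}) := (hF.subset Set.sdiff_subset).isClosed
    exact mem_nhdsWithin_of_mem_nhds (hc.isOpen_compl.mem_nhds (by simp))
  obtain ⟨b, hb, hsub⟩ := mem_nhdsGT_iff_exists_Ioo_subset.1 hev
  have hlc : ∀ t ∈ Set.Ioo x b, IsLocallyConstantAt M t := by
    intro t ht
    by_contra hn
    exact hsub ht ⟨hn, ht.1.ne'⟩
  have hb' : x < b := hb
  refine ⟨b - x, by linarith, ?_⟩
  intro y hxy hy
  have hyb : y < b := by linarith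
  rcases hxy.eq_or_lt with rfl | hlt
  · have : M.map (homOfLE hxy) = 𝟙 _ := M.map_id _
    rw [this]; infer_instance
  have hiso : ∀ t : ℝ, x < t → IsIso (M.map (homOfLE (min_le_left y t))) := fun t ht =>
    isIso_map_of_locallyConstant hlc _ (lt_min hlt ht) hyb
  let φ : ∀ t : ℝ, x < t → (M.obj y ⟶ M.obj t) := fun t ht =>
    haveI := hiso t ht
    inv (M.map (homOfLE (min_le_left y t))) ≫ M.map (homOfLE (min_le_right y t))
  have hφ : ∀ (s t : ℝ) (hs : x < s) (ht : x < t) (hst : s ≤ t),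
      φ s hs ≫ M.map (homOfLE hst) = φ t ht := by
    intro s t hs ht hst
    have := hiso s hs
    have := hiso t ht
    have h1 := map_homOfLE_comp M (min_le_min_left y hst) (min_le_left y t)
    simp only [φ]
    rw [Category.assoc, map_homOfLE_comp, IsIso.inv_comp_eq, ← h1, Category.assoc,
      IsIso.hom_inv_id_assoc, map_homOfLE_comp]
  let c : Cone (rightDiagram M x) :=
    { pt := M.obj y
      π :=
        { app := fun t => φ t.1 t.2
          naturality := fun s t f =>
            (Category.id_comp _).trans (hφ s.1 t.1 s.2 t.2 (leOfHom f)).symm } }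
  obtain ⟨l, hl1⟩ : ∃ l : M.obj y ⟶ M.obj x,
      ∀ (t : ℝ) (ht : x < t), l ≫ M.map (homOfLE ht.le) = φ t ht :=
    ⟨hl.lift c, fun t ht => hl.fac c ⟨t, ht⟩⟩
  have hext : ∀ f g : M.obj x ⟶ M.obj x, (∀ (t : ℝ) (ht : x < t),
      f ≫ M.map (homOfLE ht.le) = g ≫ M.map (homOfLE ht.le)) → f = g :=
    fun f g h => hl.hom_ext fun t => h t.1 t.2
  refine ⟨l, hext _ _ fun t ht => ?_, (hl1 y hlt).trans ?_⟩
  · have := hiso t ht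
    rw [Category.assoc, hl1 t ht, ← map_homOfLE_comp M (le_min hxy ht.le) (min_le_left y t)]
    simp only [φ]
    rw [Category.assoc, IsIso.hom_inv_id_assoc, map_homOfLE_comp, Category.id_comp]
  · have := hiso y hlt
    simp only [φ]
    rw [IsIso.inv_comp_eq, Category.comp_id]

/-- A functor built from finitely many objects of the category by an operation that preserves
invertibility of structure maps is again in the category. -/
lemma isIT_of_finite {J : Type*} [Finite J] (F : J → ℝ ⥤ D) (hF : ∀ j, isIT D (F j)) (N : ℝ ⥤ D)
    (hN : ∀ (y z : ℝ) (h : y ≤ z), (∀ j, IsIso ((F j).map (homOfLE h))) →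
      IsIso (N.map (homOfLE h))) : isIT D N := by
  have small : ∀ (p : J → ℝ → Prop), (∀ j, ∃ ε > 0, p j ε) →
      (∀ j ε δ, 0 < δ → δ ≤ ε → p j ε → p j δ) → ∃ ε > 0, ∀ j, p j ε := by
    intro p h hmono
    have : ∀ᶠ ε in nhdsWithin (0 : ℝ) (Set.Ioi 0), ∀ j, p j ε := by
      rw [Filter.eventually_all]
      intro j
      obtain ⟨ε, hε, hp⟩ := h j
      filter_upwards [Ioo_mem_nhdsGT hε] with δ hδ
      exact hmono j ε δ hδ.1 hδ.2.le hp
    obtain ⟨ε, h1, h2⟩ := (this.and self_mem_nhdsWithin).exists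
    exact ⟨ε, h2, h1⟩
  refine ⟨fun x => isRightContinuousAt_of_isRightConstantAt ?_, ?_⟩
  · obtain ⟨ε, hε, h⟩ := small
      (fun j ε => ∀ (y : ℝ) (h : x ≤ y), y < x + ε → IsIso ((F j).map (homOfLE h)))
      (fun j => isRightConstantAt_of_isIT (hF j) x)
      (fun j ε δ _ hle h y hy hyδ => h y hy (by linarith))
    exact ⟨ε, hε, fun y hy hyε => hN x y hy fun j => h j y hy hyε⟩
  · refine (Set.finite_iUnion fun j => (hF j).2).subset ?_
    intro x hx
    by_contra hn
    simp only [Set.mem_iUnion, Set.mem_ofPred_eq, not_exists, not_not] at hn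
    apply hx
    obtain ⟨ε, hε, h⟩ := small
      (fun j ε => ∀ (y z : ℝ) (h : y ≤ z), x - ε < y → z < x + ε → IsIso ((F j).map (homOfLE h)))
      hn (fun j ε δ _ hle h y z hyz hy hz => h y z hyz (by linarith) (by linarith))
    exact ⟨ε, hε, fun y z hyz hy hz => hN y z hyz fun j => h j y z hyz hy hz⟩

/-- Pointwise finite limits stay in the category. -/
instance isIT_closedUnderLimits {J : Type*} [Category J] [Finite J] [HasLimitsOfShape J D] :
    (isIT D).IsClosedUnderLimitsOfShape J where
  limitsOfShape_le := by
    rintro N ⟨p⟩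
    refine isIT_of_finite p.diag.obj p.prop_diag_obj N fun y z h hj => ?_
    have hl (t : ℝ) := isLimitOfPreserves ((evaluation ℝ D).obj t) p.isLimit
    let α : p.diag ⋙ (evaluation ℝ D).obj y ⟶ p.diag ⋙ (evaluation ℝ D).obj z :=
      Functor.whiskerLeft p.diag ((evaluation ℝ D).map (homOfLE h))
    have : ∀ j, IsIso (α.app j) := hj
    have : IsIso α := NatIso.isIso_of_isIso_app α
    have : N.map (homOfLE h) = ((hl y).conePointsIsoOfNatIso (hl z) (asIso α)).hom := by
      refine (hl z).hom_ext fun j => ?_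
      rw [IsLimit.conePointsIsoOfNatIso_hom_comp]
      exact ((p.π.app j).naturality (homOfLE h))
    rw [this]
    infer_instance

/-- Pointwise finite colimits stay in the category. -/
instance isIT_closedUnderColimits {J : Type*} [Category J] [Finite J] [HasColimitsOfShape J D] :
    (isIT D).IsClosedUnderColimitsOfShape J where
  colimitsOfShape_le := by
    rintro N ⟨p⟩
    refine isIT_of_finite p.diag.obj p.prop_diag_obj N fun y z h hj => ?_
    have hl (t : ℝ) := isColimitOfPreserves ((evaluation ℝ D).obj t) p.isColimit
    let α : p.diag ⋙ (evaluation ℝ D).obj y ⟶ p.diag ⋙ (evaluation ℝ D).obj z :=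
      Functor.whiskerLeft p.diag ((evaluation ℝ D).map (homOfLE h))
    have : ∀ j, IsIso (α.app j) := hj
    have : IsIso α := NatIso.isIso_of_isIso_app α
    have : N.map (homOfLE h) = ((hl y).coconePointsIsoOfNatIso (hl z) (asIso α)).hom := by
      refine (hl y).hom_ext fun j => ?_
      rw [IsColimit.comp_coconePointsIsoOfNatIso_hom]
      exact ((p.ι.app j).naturality (homOfLE h)).symm
    rw [this]
    infer_instance

instance isIT_closedUnderFiniteProducts [HasFiniteProducts D] :
    (isIT D).IsClosedUnderFiniteProducts where
  isClosedUnderLimitsOfShape _ _ := isIT_closedUnderLimits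

instance isIT_closedUnderKernels [HasZeroMorphisms D] [HasLimitsOfShape WalkingParallelPair D] :
    (isIT D).IsClosedUnderKernels where
  kernels_le := by
    rintro _ ⟨f, k, hk, hf⟩
    exact (isIT D).prop_of_isLimit hk (by rintro (_ | _) <;> [exact hf.1; exact hf.2])

instance isIT_closedUnderCokernels [HasZeroMorphisms D]
    [HasColimitsOfShape WalkingParallelPair D] : (isIT D).IsClosedUnderCokernels where
  cokernels_le := by
    rintro _ ⟨f, k, hk, hf⟩
    exact (isIT D).prop_of_isColimit hk (by rintro (_ | _) <;> [exact hf.1; exact hf.2])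

instance isIT_containsZero [HasZeroMorphisms D] [HasZeroObject D] : (isIT D).ContainsZero where
  exists_zero := by
    obtain ⟨Z, hZ⟩ := HasZeroObject.zero (C := D)
    refine ⟨(Functor.const ℝ).obj Z, Functor.isZero _ fun _ => hZ, isIT_of_finite (fun j : PEmpty.{1} => j.elim) (fun j => j.elim) _
      fun y z h _ => ?_⟩
    change IsIso (𝟙 Z)
    infer_instance

/-- Igusa and Todorov's category `IT(ℝ)` over the field `k`: the full subcategory of the category of
functors from the poset `ℝ` to finite-dimensional `k`-vector spaces. By the closure properties above
it is an abelian category. -/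
abbrev IT (k : Type u) [Field k] : Type (u + 1) :=
  (isIT (FGModuleCat.{u} k)).FullSubcategory

end IT

end JHS

end

/-! Subobjects of `X` in `IT k` are the same as right continuous subfunctors `ClosedSub X.obj`. The
point is `ClosedSub.isIT_functor`: right continuity of a subfunctor already forces finitely many
jumps, because on an interval where `X` is constant the subspaces only grow inside one
finite-dimensional space. Hence subobjects can be built pointwise.

Limits of chains are pointwise intersections, attained at each point by finite dimensionality; this
gives the axiom on sums. Colimits are right continuous hulls of unions. An element of the hull
enters a member of the chain as soon as it is moved to the right, which gives the axiom on
intersections and lets cocones into any object of `IT k` extend uniquely to the hull.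

Gluing `P < Y` at a suitable real number yields a subobject strictly between them, so `Subobject X`
is densely ordered and nothing is simple. A maximal chain is then a composition series without
subfactors, so no nonzero object is JHS. -/

noncomputable section

namespace JHS

variable {k : Type u} [Field k]

/-! ### Functors on the real line in terms of linear maps -/

section Elementwise

variable {M N : ℝ ⥤ FGModuleCat.{u} k}

/-- The structure maps of a functor on `ℝ`, as linear maps. -/
def tr (M : ℝ ⥤ FGModuleCat.{u} k) {x y : ℝ} (h : x ≤ y) : M.obj x →ₗ[k] M.obj y :=
  (M.map (homOfLE h)).hom.hom

lemma tr_tr {x y z : ℝ} (h : x ≤ y) (h' : y ≤ z) (m : M.obj x) :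
    tr M h' (tr M h m) = tr M (h.trans h') m := by
  simp only [tr, ← map_homOfLE_comp M h h']
  rfl

lemma tr_refl {x : ℝ} (m : M.obj x) : tr M (le_refl x) m = m := by
  have : M.map (homOfLE (le_refl x)) = 𝟙 _ := M.map_id _
  simp only [tr, this]
  rfl

lemma isIso_iff_bijective {V W : FGModuleCat.{u} k} (f : V ⟶ W) :
    IsIso f ↔ Function.Bijective f.hom.hom := by
  rw [← isIso_iff_of_reflects_iso f (forget₂ (FGModuleCat.{u} k) (ModuleCat.{u} k)),
    ConcreteCategory.isIso_iff_bijective]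
  rfl

lemma isIso_map_iff {x y : ℝ} (h : x ≤ y) :
    IsIso (M.map (homOfLE h)) ↔ Function.Bijective (tr M h) :=
  isIso_iff_bijective _

/-- The components of a natural transformation, as linear maps. -/
def cmp (f : M ⟶ N) (x : ℝ) : M.obj x →ₗ[k] N.obj x :=
  (f.app x).hom.hom

lemma cmp_tr (f : M ⟶ N) {x y : ℝ} (h : x ≤ y) (m : M.obj x) :
    cmp f y (tr M h m) = tr N h (cmp f x m) := by
  have := congrArg (fun g => g.hom.hom m) (f.naturality (homOfLE h))
  exact this

lemma natTrans_ext {f g : M ⟶ N} (h : ∀ x m, cmp f x m = cmp g x m) : f = g := by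
  ext x : 2
  exact FGModuleCat.hom_ext (LinearMap.ext (h x))

/-- A natural transformation from a compatible family of linear maps. -/
def natMk (φ : ∀ x, M.obj x →ₗ[k] N.obj x)
    (hφ : ∀ (x y : ℝ) (h : x ≤ y) (m : M.obj x), φ y (tr M h m) = tr N h (φ x m)) : M ⟶ N where
  app x := ObjectProperty.homMk (ModuleCat.ofHom (φ x))
  naturality x y f := FGModuleCat.hom_ext (LinearMap.ext (hφ x y (leOfHom f)))

lemma isIso_of_bijective_cmp (f : M ⟶ N) (h : ∀ x, Function.Bijective (cmp f x)) : IsIso f := by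
  have : ∀ x, IsIso (f.app x) := fun x => (isIso_iff_bijective _).2 (h x)
  exact NatIso.isIso_of_isIso_app f

/-- Near `x` on the right, the structure maps starting at `x` are bijective. -/
lemma exists_bijective_tr (hM : isIT _ M) (x : ℝ) :
    ∃ b > x, ∀ (y : ℝ) (h : x ≤ y), y < b → Function.Bijective (tr M h) := by
  obtain ⟨ε, hε, h⟩ := isRightConstantAt_of_isIT hM x
  exact ⟨x + ε, by linarith, fun y hy hlt => (isIso_map_iff hy).1 (h y hy hlt)⟩

/-- Structure maps out of `x` are injective over a short distance. This makes pointwise kernels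
right continuous and right continuous extensions of maps unique. -/
lemma eq_of_tr_eq (hM : isIT _ M) {x : ℝ} {m n : M.obj x}
    (h : ∀ (y : ℝ) (hy : x < y), tr M hy.le m = tr M hy.le n) : m = n := by
  obtain ⟨b, hb, H⟩ := exists_bijective_tr hM x
  obtain ⟨y, hxy, hyb⟩ := exists_between hb
  exact (H y hxy.le hyb).1 (h y hxy)

end Elementwise

/-! ### Right continuous subfunctors have finitely many jumps -/

/-- Right continuous subfunctors of a functor on `ℝ`. -/
structure ClosedSub (M : ℝ ⥤ FGModuleCat.{u} k) where
  /-- The pointwise submodules. -/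
  carrier (x : ℝ) : Submodule k (M.obj x)
  tr_mem {x y : ℝ} (h : x ≤ y) {m : M.obj x} : m ∈ carrier x → tr M h m ∈ carrier y
  mem_of_tr {x : ℝ} {m : M.obj x} :
    (∀ (y : ℝ) (h : x < y), tr M h.le m ∈ carrier y) → m ∈ carrier x

namespace ClosedSub

variable {M : ℝ ⥤ FGModuleCat.{u} k} (R : ClosedSub M)

/-- The functor underlying a right continuous subfunctor. -/
def functor : ℝ ⥤ FGModuleCat.{u} k where
  obj x := FGModuleCat.of k (R.carrier x)
  map f := FGModuleCat.ofHom
    ((tr M (leOfHom f)).restrict fun _ hm => R.tr_mem (leOfHom f) hm)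
  map_id _ := FGModuleCat.hom_ext (LinearMap.ext fun _ => Subtype.ext (tr_refl _))
  map_comp f g := FGModuleCat.hom_ext (LinearMap.ext fun _ => Subtype.ext
    (tr_tr (leOfHom f) (leOfHom g) _).symm)

/-- The inclusion of a right continuous subfunctor. -/
def incl : R.functor ⟶ M :=
  natMk (fun x => (R.carrier x).subtype) fun _ _ _ _ => rfl

lemma injective_tr_functor {x y : ℝ} (h : x ≤ y) (hM : Function.Injective (tr M h)) :
    Function.Injective (tr R.functor h) := fun _ _ hab =>
  Subtype.ext (hM (congrArg Subtype.val (show (show R.carrier y from _) = _ from hab)))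

lemma bijective_tr_functor {x y : ℝ} (h : x ≤ y) (hM : Function.Injective (tr M h))
    (hs : ∀ m ∈ R.carrier y, ∃ n ∈ R.carrier x, tr M h n = m) :
    Function.Bijective (tr R.functor h) := by
  refine ⟨R.injective_tr_functor h hM, fun m => ?_⟩
  obtain ⟨n, hn, e⟩ := hs m.1 m.2
  exact ⟨⟨n, hn⟩, Subtype.ext e⟩

/-- Near `x` on the right, every element of a right continuous subfunctor comes from `x`. -/
lemma exists_lift (hM : isIT _ M) (x : ℝ) : ∃ b > x, ∀ (y : ℝ) (h : x ≤ y), y < b →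
    Function.Bijective (tr M h) ∧ ∀ m ∈ R.carrier y, ∃ n ∈ R.carrier x, tr M h n = m := by
  obtain ⟨b, hb, H⟩ := exists_bijective_tr hM x
  -- Pulled back to `M(x)`, the subspaces increase with `y`, so by the descending chain condition
  -- they are constant near `x`.
  let V : Set.Ioo x b → Submodule k (M.obj x) := fun y => (R.carrier y).comap (tr M y.2.1.le)
  have hV : ∀ y z : Set.Ioo x b, y ≤ z → V y ≤ V z := by
    intro y z hyz m hm
    have := R.tr_mem (show (y : ℝ) ≤ z from hyz) hm
    rwa [tr_tr] at this
  obtain ⟨c, hc⟩ := exists_between hb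
  obtain ⟨y₀, hmin⟩ : ∃ y₀, ∀ y, V y₀ ≤ V y := by
    obtain ⟨_, ⟨y₀, rfl⟩, hy₀⟩ := wellFounded_lt.has_min (Set.range V) ⟨_, ⟨c, hc⟩, rfl⟩
    refine ⟨y₀, fun y => ?_⟩
    rcases le_total y₀ y with h | h
    · exact hV _ _ h
    · by_contra hn
      exact hy₀ _ ⟨y, rfl⟩ (lt_of_le_not_ge (hV _ _ h) hn)
  refine ⟨y₀, y₀.2.1, fun y h hy => ?_⟩
  have hyb := hy.trans y₀.2.2
  refine ⟨H y h hyb, fun m hm => ?_⟩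
  obtain ⟨n, rfl⟩ := (H y h hyb).2 m
  refine ⟨n, R.mem_of_tr fun z hz => ?_, rfl⟩
  have h₀ : n ∈ V y₀ := by
    have := R.tr_mem hy.le hm
    rwa [tr_tr] at this
  rcases lt_or_ge z b with hzb | hzb
  · exact hmin ⟨z, hz, hzb⟩ h₀
  · have := R.tr_mem (y₀.2.2.le.trans hzb) h₀
    rwa [tr_tr] at this

/-- If `R(a) → R(y)` is onto for some `a < y` and `M` is constant around `[a, y]`, then `R` is
locally constant at `y`. -/
lemma isLocallyConstantAt_functor (hM : isIT _ M) {a y c : ℝ} (hay : a < y) (hyc : y < c)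
    (hc : ∀ (s t : ℝ) (h : s ≤ t), a ≤ s → t < c → Function.Injective (tr M h))
    (hs : ∀ m ∈ R.carrier y, ∃ n ∈ R.carrier a, tr M hay.le n = m) :
    IsLocallyConstantAt R.functor y := by
  obtain ⟨b, hb, H⟩ := R.exists_lift hM y
  refine ⟨min (y - a) (min (b - y) (c - y)),
    lt_min (by linarith) (lt_min (by linarith) (by linarith)), fun s t hst h1 h2 => ?_⟩
  have e1 := min_le_left (y - a) (min (b - y) (c - y))
  have e2 := (min_le_right (y - a) (min (b - y) (c - y))).trans (min_le_left _ _)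
  have e3 := (min_le_right (y - a) (min (b - y) (c - y))).trans (min_le_right _ _)
  have has : a ≤ s := by linarith
  refine (isIso_map_iff hst).2 (R.bijective_tr_functor hst (hc _ _ hst has (by linarith)) ?_)
  -- A lift to `a` gives one to `s` by transport, as `a ≤ s`.
  suffices ∀ m ∈ R.carrier t, ∃ n ∈ R.carrier a, tr M (has.trans hst) n = m by
    intro m hm
    obtain ⟨n, hn, rfl⟩ := this m hm
    exact ⟨tr M has n, R.tr_mem _ hn, tr_tr _ _ _⟩
  intro m hm
  rcases le_total y t with hyt | hty
  · obtain ⟨m', hm', rfl⟩ := (H t hyt (by linarith)).2 m hm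
    obtain ⟨n, hn, rfl⟩ := hs m' hm'
    exact ⟨n, hn, (tr_tr _ _ _).symm⟩
  -- Left of `y`: push to `y`, lift to `a`, and compare at `y` by injectivity.
  · obtain ⟨n, hn, e⟩ := hs _ (R.tr_mem hty hm)
    refine ⟨n, hn, hc t y hty (has.trans hst) hyc ?_⟩
    rw [tr_tr, e]

/-- Within a component of the set where `M` is locally constant, the dimension of `R` cannot
decrease, and it separates the points where `R` fails to be locally constant. As it is bounded by
the dimension of `M`, each component contains finitely many such points. -/
theorem isIT_functor (hM : isIT _ M) : isIT _ R.functor := by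
  refine ⟨fun x => isRightContinuousAt_of_isRightConstantAt ?_, ?_⟩
  · obtain ⟨b, hb, H⟩ := R.exists_lift hM x
    exact ⟨b - x, by linarith, fun y h hy => (isIso_map_iff h).2
      (R.bijective_tr_functor h (H y h (by linarith)).1.1 (H y h (by linarith)).2)⟩
  · set F := {x | ¬ IsLocallyConstantAt M x} with hF
    have hfin : F.Finite := hM.2
    suffices ({x | ¬ IsLocallyConstantAt R.functor x} \ F).Finite from
      (this.union hfin).subset fun x hx => by
        by_cases h : x ∈ F
        · exact Or.inr h
        · exact Or.inl ⟨hx, h⟩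
    -- Off `F`, the set `F ∩ Set.Iio x` labels the component of `x` in the complement of `F`; there
    -- are finitely many labels.
    refine Set.Finite.of_finite_fibers (fun x => F ∩ Set.Iio x)
      (hfin.finite_subsets.subset ?_) ?_
    · rintro _ ⟨x, -, rfl⟩
      exact Set.inter_subset_left
    · rintro B -
      have key : ∀ x y : ℝ, x ∉ F → y ∉ F → F ∩ Set.Iio x = F ∩ Set.Iio y → x < y →
          ∃ c > y, ∀ (s t : ℝ) (h : s ≤ t), x ≤ s → t < c →
            Function.Bijective (tr M h) := by
        intro x y hx hy hxy hlt
        have hop : IsOpen Fᶜ := hfin.isClosed.isOpen_compl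
        obtain ⟨a, hax, ha⟩ := exists_Ioc_subset_of_mem_nhds (hop.mem_nhds hx) (exists_lt x)
        obtain ⟨c, hyc, hc⟩ := exists_Ico_subset_of_mem_nhds (hop.mem_nhds hy) (exists_gt y)
        refine ⟨c, hyc, fun s t h hs ht => (isIso_map_iff h).1
          (isIso_map_of_locallyConstant (a := a) (b := c) (fun z hz => ?_) h
            (hax.trans_le hs) ht)⟩
        by_contra hzF
        rcases le_or_gt z x with hzx | hzx
        · exact ha ⟨hz.1, hzx⟩ hzF
        rcases lt_or_ge z y with hzy | hzy
        · have : z ∈ F ∩ Set.Iio x := hxy ▸ ⟨hzF, hzy⟩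
          exact lt_asymm hzx this.2
        · exact hc ⟨hzy, hz.2⟩ hzF
      have hlt : ∀ x y : ℝ, x ∉ F → y ∉ F → F ∩ Set.Iio x = F ∩ Set.Iio y → x < y →
          ¬ IsLocallyConstantAt R.functor y →
          Module.finrank k (R.carrier x) ≠ Module.finrank k (R.carrier y) := by
        intro x y hx hy hxy hlt hn heq
        obtain ⟨c, hyc, hc⟩ := key x y hx hy hxy hlt
        refine hn (R.isLocallyConstantAt_functor hM hlt hyc
          (fun s t h hs ht => (hc s t h hs ht).1) fun m hm => ?_)
        have hinj := R.injective_tr_functor hlt.le (hc x y hlt.le le_rfl hyc).1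
        have hsurj := (LinearMap.injective_iff_surjective_of_finrank_eq_finrank (V := R.carrier x)
          (V₂ := R.carrier y) (f := tr R.functor hlt.le) heq).1 hinj
        obtain ⟨n, hn⟩ := hsurj ⟨m, hm⟩
        exact ⟨n.1, n.2, congrArg Subtype.val hn⟩
      rcases Set.eq_empty_or_nonempty
        (({x | ¬ IsLocallyConstantAt R.functor x} \ F) ∩ (fun x => F ∩ Set.Iio x) ⁻¹' {B})
        with he | ⟨x₀, ⟨hx₀, hx₀F⟩, hx₀B⟩
      · rw [he]; exact Set.finite_empty
      -- By `hlt`, dimension is injective on the bad points of one component.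
      refine Set.Finite.of_finite_image (f := fun x => Module.finrank k (R.carrier x))
        ((Set.finite_Iic (Module.finrank k (M.obj x₀))).subset ?_) ?_
      · rintro _ ⟨x, ⟨⟨hx, hxF⟩, hxB⟩, rfl⟩
        refine (Submodule.finrank_le _).trans (le_of_eq ?_)
        have hB : F ∩ Set.Iio x = F ∩ Set.Iio x₀ := hxB.trans hx₀B.symm
        rcases lt_trichotomy x x₀ with h | rfl | h
        · obtain ⟨c, hc, H⟩ := key x x₀ hxF hx₀F hB h
          exact (LinearEquiv.ofBijective _ (H x x₀ h.le le_rfl hc)).finrank_eq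
        · rfl
        · obtain ⟨c, hc, H⟩ := key x₀ x hx₀F hxF hB.symm h
          exact (LinearEquiv.ofBijective _ (H x₀ x h.le le_rfl hc)).finrank_eq.symm
      · rintro x ⟨⟨hx, hxF⟩, hxB⟩ y ⟨⟨hy, hyF⟩, hyB⟩ hxy
        have hB : F ∩ Set.Iio x = F ∩ Set.Iio y := hxB.trans hyB.symm
        rcases lt_trichotomy x y with h | h | h
        · exact absurd hxy (hlt x y hxF hyF hB h hy)
        · exact h
        · exact absurd hxy.symm (hlt y x hyF hxF hB.symm h hx)

end ClosedSub

/-! ### Subobjects as right continuous subfunctors -/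

variable {X T : IT k}

namespace ClosedSub

/-- A right continuous subfunctor of an object of `IT(ℝ)`, as an object of `IT(ℝ)`. -/
def toIT (R : ClosedSub X.obj) : IT k := ⟨R.functor, R.isIT_functor X.property⟩

/-- The inclusion of a right continuous subfunctor, as a morphism of `IT(ℝ)`. -/
def ι (R : ClosedSub X.obj) : R.toIT ⟶ X := ObjectProperty.homMk R.incl

lemma cmp_ι_injective (R : ClosedSub X.obj) (x : ℝ) : Function.Injective (cmp R.ι.hom x) :=
  Subtype.val_injective

/-- The pointwise kernel of a morphism of `IT(ℝ)`. -/
def ker (f : T ⟶ X) : ClosedSub T.obj where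
  carrier x := (cmp f.hom x).ker
  tr_mem h m hm := by
    rw [LinearMap.mem_ker] at hm ⊢
    rw [cmp_tr, hm, map_zero]
  mem_of_tr {x m} H := by
    rw [LinearMap.mem_ker]
    refine eq_of_tr_eq X.property fun y hy => ?_
    rw [← cmp_tr, map_zero]
    exact H y hy

/-- The pointwise range of a morphism of `IT(ℝ)`. -/
def range (f : T ⟶ X) : ClosedSub X.obj where
  carrier x := (cmp f.hom x).range
  tr_mem := by
    rintro x y h _ ⟨t, rfl⟩
    exact ⟨tr _ h t, cmp_tr _ _ _⟩
  mem_of_tr {x m} H := by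
    -- At a `y` so close to `x` that both `X` and `T` are constant on `[x, y]`, a preimage can be
    -- carried back to `x`.
    obtain ⟨b, hb, hX⟩ := exists_bijective_tr X.property x
    obtain ⟨c, hc, hT⟩ := exists_bijective_tr T.property x
    obtain ⟨y, hxy, hy⟩ := exists_between (lt_min hb hc)
    obtain ⟨t, ht⟩ := H y hxy
    obtain ⟨s, rfl⟩ := (hT y hxy.le (hy.trans_le (min_le_right _ _))).2 t
    refine ⟨s, (hX y hxy.le (hy.trans_le (min_le_left _ _))).1 ?_⟩
    rw [← ht, cmp_tr]

end ClosedSub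

lemma hom_ext_cmp {f g : T ⟶ X} (h : ∀ x m, cmp f.hom x m = cmp g.hom x m) : f = g :=
  ObjectProperty.hom_ext _ (natTrans_ext h)

lemma mono_of_injective_cmp (f : T ⟶ X) (h : ∀ x, Function.Injective (cmp f.hom x)) : Mono f where
  right_cancellation _ _ hab := hom_ext_cmp fun x m => h x
    (congrArg (fun (g : _ ⟶ X) => cmp g.hom x m) hab)

instance (R : ClosedSub X.obj) : Mono R.ι := mono_of_injective_cmp _ R.cmp_ι_injective

/-- The pointwise kernel is itself an object of `IT k`, so a monomorphism forces its inclusion to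
vanish. -/
lemma injective_cmp_of_mono (f : T ⟶ X) [Mono f] (x : ℝ) : Function.Injective (cmp f.hom x) := by
  rw [← LinearMap.ker_eq_bot, eq_bot_iff]
  intro m hm
  have h0 : (ClosedSub.ker f).ι = 0 := by
    rw [← cancel_mono f, zero_comp]
    exact hom_ext_cmp fun y n => n.2
  exact congrArg (fun (g : (ClosedSub.ker f).toIT ⟶ T) => cmp g.hom x ⟨m, hm⟩) h0

lemma ClosedSub.exists_factor (R : ClosedSub X.obj) (f : T ⟶ X)
    (hf : ∀ x m, cmp f.hom x m ∈ R.carrier x) : ∃ g : T ⟶ R.toIT, g ≫ R.ι = f :=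
  ⟨ObjectProperty.homMk (natMk (N := R.functor) (fun x => (cmp f.hom x).codRestrict _ (hf x))
    fun _ _ h m => Subtype.ext (cmp_tr f.hom h m)), hom_ext_cmp fun _ _ => rfl⟩

/-- The right continuous subfunctor corresponding to a subobject. -/
def fib (S : Subobject X) : ClosedSub X.obj := ClosedSub.range S.arrow

/-- The subobject given by a right continuous subfunctor. -/
def ClosedSub.toSubobject (R : ClosedSub X.obj) : Subobject X := Subobject.mk R.ι

lemma toSubobject_fib (S : Subobject X) : (fib S).toSubobject = S := by
  obtain ⟨g, hg⟩ := (fib S).exists_factor S.arrow fun x m => ⟨m, rfl⟩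
  have hb (x : ℝ) : Function.Bijective (cmp g.hom x) := by
    have e (m) : (show (fib S).carrier x from cmp g.hom x m).1 = cmp S.arrow.hom x m :=
      congrArg (fun (h : _ ⟶ X) => cmp h.hom x m) hg
    refine ⟨fun a b hab => injective_cmp_of_mono S.arrow x ?_, ?_⟩
    · rw [← e, ← e, hab]
    · rintro ⟨_, m, rfl⟩
      exact ⟨m, Subtype.ext (e m)⟩
  have : IsIso g.hom := isIso_of_bijective_cmp _ hb
  have : IsIso g := (ObjectProperty.isIso_hom_iff g).1 this
  exact (Subobject.eq_mk_of_comm _ (asIso g) hg).symm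

/-- This pointwise test reduces order, meets and joins of subobjects to linear algebra at each real
number. -/
lemma ClosedSub.factors_toSubobject_iff (R : ClosedSub X.obj) (f : T ⟶ X) :
    R.toSubobject.Factors f ↔ ∀ x m, cmp f.hom x m ∈ R.carrier x := by
  rw [ClosedSub.toSubobject, Subobject.mk_factors_iff]
  constructor
  · rintro ⟨g, rfl⟩ x m
    exact (show R.carrier x from cmp g.hom x m).2
  · exact R.exists_factor f

lemma factors_iff_mem_fib (S : Subobject X) (f : T ⟶ X) :
    S.Factors f ↔ ∀ x m, cmp f.hom x m ∈ (fib S).carrier x := by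
  rw [← (fib S).factors_toSubobject_iff, toSubobject_fib]

lemma le_iff_fib_le {S U : Subobject X} :
    S ≤ U ↔ ∀ x, (fib S).carrier x ≤ (fib U).carrier x := by
  constructor
  · rintro h x _ ⟨m, rfl⟩
    exact (factors_iff_mem_fib U S.arrow).1 (Subobject.factors_of_le _ h (Subobject.factors_self S))
      x m
  · intro h
    exact Subobject.le_of_factors ((factors_iff_mem_fib U S.arrow).2 fun x m => h x ⟨m, rfl⟩)

lemma fib_toSubobject (R : ClosedSub X.obj) (x : ℝ) :
    (fib R.toSubobject).carrier x = R.carrier x := by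
  apply le_antisymm
  · rintro _ ⟨m, rfl⟩
    exact (R.factors_toSubobject_iff _).1 (Subobject.factors_self _) x m
  · intro m hm
    exact (factors_iff_mem_fib R.toSubobject R.ι).1 (Subobject.mk_factors_self _) x ⟨m, hm⟩

lemma fib_inf (S U : Subobject X) (x : ℝ) :
    (fib (S ⊓ U)).carrier x = (fib S).carrier x ⊓ (fib U).carrier x := by
  let R : ClosedSub X.obj :=
    { carrier := fun x => (fib S).carrier x ⊓ (fib U).carrier x
      tr_mem := fun h m hm => ⟨(fib S).tr_mem h hm.1, (fib U).tr_mem h hm.2⟩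
      mem_of_tr := fun H => ⟨(fib S).mem_of_tr fun y hy => (H y hy).1,
        (fib U).mem_of_tr fun y hy => (H y hy).2⟩ }
  have : R.toSubobject = S ⊓ U := by
    refine le_antisymm (le_inf ?_ ?_) ?_ <;> rw [le_iff_fib_le] <;> intro y <;>
      rw [fib_toSubobject]
    · exact inf_le_left
    · exact inf_le_right
    · exact le_inf (le_iff_fib_le.1 inf_le_left y) (le_iff_fib_le.1 inf_le_right y)
  rw [← this, fib_toSubobject]

lemma fib_sup (S U : Subobject X) (x : ℝ) :
    (fib (S ⊔ U)).carrier x = (fib S).carrier x ⊔ (fib U).carrier x := by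
  let R : ClosedSub X.obj :=
    { carrier := fun x => (fib S).carrier x ⊔ (fib U).carrier x
      tr_mem := fun {x y} h m hm => by
        obtain ⟨s, hs, t, ht, rfl⟩ := Submodule.mem_sup.1 hm
        rw [map_add]
        exact Submodule.add_mem_sup ((fib S).tr_mem h hs) ((fib U).tr_mem h ht)
      -- A sum of two subobjects needs no hull: close to `x` both summands lift to `x`.
      mem_of_tr := fun {x m} H => by
        obtain ⟨b, hb, hS⟩ := (fib S).exists_lift X.property x
        obtain ⟨c, hc, hU⟩ := (fib U).exists_lift X.property x
        obtain ⟨y, hxy, hy⟩ := exists_between (lt_min hb hc)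
        obtain ⟨hi, hS⟩ := hS y hxy.le (hy.trans_le (min_le_left _ _))
        obtain ⟨-, hU⟩ := hU y hxy.le (hy.trans_le (min_le_right _ _))
        obtain ⟨s, hs, t, ht, e⟩ := Submodule.mem_sup.1 (H y hxy)
        obtain ⟨s, hs', rfl⟩ := hS s hs
        obtain ⟨t, ht', rfl⟩ := hU t ht
        rw [← map_add] at e
        rw [← hi.1 e]
        exact Submodule.add_mem_sup hs' ht' }
  have : R.toSubobject = S ⊔ U := by
    refine le_antisymm ?_ (sup_le ?_ ?_) <;> rw [le_iff_fib_le] <;> intro y <;>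
      rw [fib_toSubobject]
    · exact sup_le (le_iff_fib_le.1 le_sup_left y) (le_iff_fib_le.1 le_sup_right y)
    · exact le_sup_left
    · exact le_sup_right
  rw [← this, fib_toSubobject]

/-! ### Infima, suprema and density in the lattice of subobjects -/

/-- The intersection of a set of subobjects. -/
def interSub (Δ : Set (Subobject X)) : ClosedSub X.obj where
  carrier x := ⨅ Y ∈ Δ, (fib Y).carrier x
  tr_mem h m hm := by
    simp only [Submodule.mem_iInf] at hm ⊢
    exact fun Y hY => (fib Y).tr_mem h (hm Y hY)
  mem_of_tr H := by
    simp only [Submodule.mem_iInf] at H ⊢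
    exact fun Y hY => (fib Y).mem_of_tr fun y hy => H y hy Y hY

/-- The right continuous hull of the sum of a set of subobjects. -/
def hullSub (Δ : Set (Subobject X)) : ClosedSub X.obj where
  carrier x := ⨅ (y : ℝ) (h : x < y), (⨆ Y ∈ Δ, (fib Y).carrier y).comap (tr _ h.le)
  tr_mem h m hm := by
    simp only [Submodule.mem_iInf, Submodule.mem_comap, tr_tr] at hm ⊢
    exact fun y hy => hm y (h.trans_lt hy)
  mem_of_tr H := by
    simp only [Submodule.mem_iInf, Submodule.mem_comap, tr_tr] at H ⊢
    intro y hy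
    obtain ⟨z, hz, hzy⟩ := exists_between hy
    exact H z hz y hzy

lemma mem_hullSub {Δ : Set (Subobject X)} {x : ℝ} {m : X.obj.obj x} :
    m ∈ (hullSub Δ).carrier x ↔
      ∀ (y : ℝ) (h : x < y), tr X.obj h.le m ∈ ⨆ Y ∈ Δ, (fib Y).carrier y := by
  simp only [hullSub, Submodule.mem_iInf, Submodule.mem_comap]

lemma mem_interSub {Δ : Set (Subobject X)} {x : ℝ} {m : X.obj.obj x} :
    m ∈ (interSub Δ).carrier x ↔ ∀ Y ∈ Δ, m ∈ (fib Y).carrier x := by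
  simp only [interSub, Submodule.mem_iInf]

lemma isGLB_interSub (Δ : Set (Subobject X)) : IsGLB Δ (interSub Δ).toSubobject := by
  refine ⟨fun Y hY => le_iff_fib_le.2 fun x m hm => ?_,
    fun S hS => le_iff_fib_le.2 fun x m hm => ?_⟩
  · rw [fib_toSubobject, mem_interSub] at hm
    exact hm Y hY
  · rw [fib_toSubobject, mem_interSub]
    exact fun Y hY => le_iff_fib_le.1 (hS hY) x hm

lemma isLUB_hullSub (Δ : Set (Subobject X)) : IsLUB Δ (hullSub Δ).toSubobject := by
  refine ⟨fun Y hY => le_iff_fib_le.2 fun x m hm => ?_,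
    fun S hS => le_iff_fib_le.2 fun x m hm => ?_⟩
  · rw [fib_toSubobject, mem_hullSub]
    exact fun y h => Submodule.mem_iSup_of_mem Y
      (Submodule.mem_iSup_of_mem hY ((fib Y).tr_mem h.le hm))
  · rw [fib_toSubobject, mem_hullSub] at hm
    exact (fib S).mem_of_tr fun y hy =>
      iSup₂_le (fun Y hY => le_iff_fib_le.1 (hS hY) y) (hm y hy)

/-- The sum of a nonempty chain of subobjects is pointwise a union. -/
lemma exists_mem_of_mem_iSup_fib {Δ : Set (Subobject X)} (hΔ : IsPreSubobjectChain Δ)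
    (hne : Δ.Nonempty) {x : ℝ} {m : X.obj.obj x} (hm : m ∈ ⨆ Y ∈ Δ, (fib Y).carrier x) :
    ∃ Y ∈ Δ, m ∈ (fib Y).carrier x := by
  have : Nonempty Δ := hne.to_subtype
  rw [iSup_subtype'] at hm
  rw [Submodule.mem_iSup_of_directed] at hm
  · obtain ⟨Y, hY⟩ := hm
    exact ⟨Y.1, Y.2, hY⟩
  · intro Y Z
    rcases hΔ.total Y.2 Z.2 with h | h
    · exact ⟨Z, le_iff_fib_le.1 h x, le_rfl⟩
    · exact ⟨Y, le_rfl, le_iff_fib_le.1 h x⟩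

/-- The pointwise intersection of a nonempty chain of subobjects is attained. -/
lemma exists_fib_eq_interSub {Δ : Set (Subobject X)} (hΔ : IsPreSubobjectChain Δ)
    (hne : Δ.Nonempty) (x : ℝ) :
    ∃ Y ∈ Δ, (fib Y).carrier x = (interSub Δ).carrier x := by
  obtain ⟨_, ⟨Y, hY, rfl⟩, hmin⟩ := wellFounded_lt.has_min
    ((fun Y : Subobject X => (fib Y).carrier x) '' Δ) (hne.image _)
  refine ⟨Y, hY, le_antisymm (fun m hm => mem_interSub.2 fun Z hZ => ?_)
    fun m hm => mem_interSub.1 hm Y hY⟩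
  rcases hΔ.total hY hZ with h | h
  · exact le_iff_fib_le.1 h x hm
  · by_contra hn
    exact hmin _ ⟨Z, hZ, rfl⟩ (lt_of_le_not_ge (le_iff_fib_le.1 h x) fun hle => hn (hle hm))

/-- Membership in the hull is tested strictly to the right of `x`, where the sum of a nonempty chain
is a union; an element also in `Z` then lies in a single `Y ⊓ Z`. -/
lemma isLUB_image_inf {Δ : Set (Subobject X)} {Z C : Subobject X} (hΔ : IsPreSubobjectChain Δ)
    (h : IsLUB Δ C) : IsLUB ((fun Y => Y ⊓ Z) '' Δ) (C ⊓ Z) := by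
  refine ⟨?_, fun S hS => ?_⟩
  · rintro _ ⟨Y, hY, rfl⟩
    exact inf_le_inf_right Z (h.1 hY)
  · obtain rfl := h.unique (isLUB_hullSub Δ)
    rcases Δ.eq_empty_or_nonempty with rfl | hne
    · exact inf_le_left.trans ((isLUB_hullSub (X := X) ∅).2 (by simp))
    · refine le_iff_fib_le.2 fun x m hm => (fib S).mem_of_tr fun y hy => ?_
      rw [fib_inf, fib_toSubobject] at hm
      obtain ⟨Y, hY, hmY⟩ := exists_mem_of_mem_iSup_fib hΔ hne (mem_hullSub.1 hm.1 y hy)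
      refine le_iff_fib_le.1 (hS ⟨Y, hY, rfl⟩) y ?_
      rw [fib_inf]
      exact ⟨hmY, (fib Z).tr_mem hy.le hm.2⟩

/-- At each `x` the intersection equals the fibre of one member `Y`, depending on `x`, so adding `Z`
commutes with it there. -/
lemma isGLB_image_sup {Δ : Set (Subobject X)} {Z L : Subobject X} (hΔ : IsPreSubobjectChain Δ)
    (hne : Δ.Nonempty) (h : IsGLB Δ L) : IsGLB ((fun Y => Y ⊔ Z) '' Δ) (L ⊔ Z) := by
  refine ⟨?_, fun S hS => ?_⟩
  · rintro _ ⟨Y, hY, rfl⟩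
    exact sup_le_sup_right (h.1 hY) Z
  · obtain rfl := h.unique (isGLB_interSub Δ)
    refine le_iff_fib_le.2 fun x => ?_
    obtain ⟨Y, hY, e⟩ := exists_fib_eq_interSub hΔ hne x
    rw [fib_sup, fib_toSubobject, ← e, ← fib_sup]
    exact le_iff_fib_le.1 (hS ⟨Y, hY, rfl⟩) x

/-- Glue `P` on `t < y` to `Y` on `t ≥ y`. The point `y` is chosen so that some `m` lies outside `P`
at `x < y` and its image is still outside `P` at `y`: the value at `x` separates the result from
`Y`, the value at `y` from `P`. -/
instance : DenselyOrdered (Subobject X) where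
  dense P Y hPY := by
    have hle := le_iff_fib_le.1 hPY.le
    obtain ⟨x, hx⟩ : ∃ x, ¬ (fib Y).carrier x ≤ (fib P).carrier x := by
      by_contra! hn
      exact hPY.not_ge (le_iff_fib_le.2 hn)
    obtain ⟨m, hm, hmP⟩ := SetLike.not_le_iff_exists.1 hx
    -- Right continuity of `P` supplies a strictly larger `y`.
    obtain ⟨y, hxy, hy⟩ : ∃ (y : ℝ) (h : x < y), tr X.obj h.le m ∉ (fib P).carrier y := by
      by_contra! hn
      exact hmP ((fib P).mem_of_tr hn)
    let R : ClosedSub X.obj :=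
      { carrier := fun t => if t < y then (fib P).carrier t else (fib Y).carrier t
        tr_mem := fun {s t} h n hn => by
          by_cases h1 : s < y
          · rw [if_pos h1] at hn
            split_ifs
            exacts [(fib P).tr_mem h hn, hle t ((fib P).tr_mem h hn)]
          · rw [if_neg h1] at hn
            rw [if_neg (fun h2 => h1 (h.trans_lt h2))]
            exact (fib Y).tr_mem h hn
        mem_of_tr := fun {s n} H => by
          split_ifs with h1
          · refine (fib P).mem_of_tr fun t ht => ?_
            obtain ⟨r, hsr, hr⟩ := exists_between (lt_min ht h1)
            have := H r hsr
            rw [if_pos (hr.trans_le (min_le_right _ _))] at this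
            have := (fib P).tr_mem (hr.le.trans (min_le_left _ _)) this
            rwa [tr_tr] at this
          · refine (fib Y).mem_of_tr fun t ht => ?_
            have := H t ht
            rwa [if_neg (fun h => h1 (ht.trans h))] at this }
    refine ⟨R.toSubobject, lt_of_le_not_ge (le_iff_fib_le.2 fun t => ?_) fun h => hy ?_,
      lt_of_le_not_ge (le_iff_fib_le.2 fun t => ?_) fun h => hmP ?_⟩
    · rw [fib_toSubobject]
      change _ ≤ if _ then _ else _
      split_ifs
      exacts [le_rfl, hle t]
    · refine le_iff_fib_le.1 h y ?_
      rw [fib_toSubobject]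
      change _ ∈ if _ then _ else _
      rw [if_neg (lt_irrefl y)]
      exact (fib Y).tr_mem hxy.le hm
    · rw [fib_toSubobject]
      change (if _ then _ else _) ≤ _
      split_ifs
      exacts [hle t, le_rfl]
    · have := le_iff_fib_le.1 h x hm
      rw [fib_toSubobject] at this
      change _ ∈ if _ then _ else _ at this
      rwa [if_pos hxy] at this

end JHS

end

noncomputable section

namespace JHS

/-! ### Chain colimits and limits against suprema and infima -/

section Lattice

variable {A : Type u} [Category.{v} A] {X : A} {Δ : Set (Subobject X)}

/-- Every upper bound `D` is the vertex of a cocone, and the induced map commutes with the arrows to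
`X`. -/
lemma IsChainColimit.isLUB {C : Subobject X} (h : IsChainColimit Δ C) : IsLUB Δ C := by
  obtain ⟨hC, ⟨hl⟩⟩ := h
  refine ⟨hC, fun D hD => ?_⟩
  replace hD : ∀ Y ∈ Δ, Y ≤ D := hD
  let f : (C : A) ⟶ (D : A) := hl.desc (chainCocone Δ D hD)
  have hf (Y : Δ) : Subobject.ofLE Y.1 C (hC Y.1 Y.2) ≫ f = Subobject.ofLE Y.1 D (hD Y.1 Y.2) :=
    hl.fac (chainCocone Δ D hD) Y
  refine Subobject.le_of_comm f (hl.hom_ext fun Y => ?_)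
  change Subobject.ofLE Y.1 C (hC Y.1 Y.2) ≫ f ≫ D.arrow =
    Subobject.ofLE Y.1 C (hC Y.1 Y.2) ≫ C.arrow
  rw [reassoc_of% hf Y, Subobject.ofLE_arrow, Subobject.ofLE_arrow]

lemma IsChainLimit.isGLB {L : Subobject X} (hne : Δ.Nonempty) (h : IsChainLimit Δ L) :
    IsGLB Δ L := by
  obtain ⟨hL, ⟨hl⟩⟩ := h
  obtain ⟨Y, hY⟩ := hne
  refine ⟨hL, fun D hD => ?_⟩
  replace hD : ∀ Y ∈ Δ, D ≤ Y := hD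
  let f : (D : A) ⟶ (L : A) := hl.lift (chainCone Δ D hD)
  have hf : f ≫ Subobject.ofLE L Y (hL Y hY) = Subobject.ofLE D Y (hD Y hY) :=
    hl.fac (chainCone Δ D hD) ⟨Y, hY⟩
  refine Subobject.le_of_comm f ?_
  rw [← Subobject.ofLE_arrow (hL Y hY), reassoc_of% hf, Subobject.ofLE_arrow]

/-- All legs of a cone over a chain agree after composition into `X`, so a cone amounts to one map
to `X` factoring through every member. -/
lemma isChainLimit_of_factors (hΔ : IsPreSubobjectChain Δ) (hne : Δ.Nonempty) {L : Subobject X}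
    (hL : ∀ Y ∈ Δ, L ≤ Y)
    (hf : ∀ (T : A) (f : T ⟶ X), (∀ Y ∈ Δ, Y.Factors f) → L.Factors f) : IsChainLimit Δ L := by
  obtain ⟨Y₀, hY₀⟩ := hne
  let p (s : Cone (chainDiagram Δ)) (Y : Δ) : s.pt ⟶ (Y.1 : A) := s.π.app Y
  have ind (s : Cone (chainDiagram Δ)) (Y Z : Δ) (h : Y.1 ≤ Z.1) :
      p s Y ≫ Y.1.arrow = p s Z ≫ Z.1.arrow := by
    have e : p s Y ≫ Subobject.ofLE Y.1 Z.1 h = p s Z := s.w (homOfLE h : Y ⟶ Z)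
    rw [← e, Category.assoc, Subobject.ofLE_arrow]
  have ind' (s : Cone (chainDiagram Δ)) (Y : Δ) :
      p s ⟨Y₀, hY₀⟩ ≫ Y₀.arrow = p s Y ≫ Y.1.arrow := by
    rcases hΔ.total hY₀ Y.2 with h | h
    · exact ind s ⟨Y₀, hY₀⟩ Y h
    · exact (ind s Y ⟨Y₀, hY₀⟩ h).symm
  have fac (s : Cone (chainDiagram Δ)) : L.Factors (p s ⟨Y₀, hY₀⟩ ≫ Y₀.arrow) := by
    refine hf _ _ fun Y hY => ?_
    rw [ind' s ⟨Y, hY⟩]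
    exact Subobject.factors_comp_arrow _
  refine ⟨hL, ⟨{ lift := fun s => L.factorThru _ (fac s)
                 fac := fun s Y => ?_
                 uniq := fun s m hm => ?_ }⟩⟩
  · change L.factorThru _ (fac s) ≫ Subobject.ofLE L Y.1 (hL Y.1 Y.2) = p s Y
    rw [← cancel_mono Y.1.arrow, ← ind' s Y, Category.assoc, Subobject.ofLE_arrow,
      L.factorThru_arrow]
  · change s.pt ⟶ (L : A) at m
    replace hm : m ≫ Subobject.ofLE L Y₀ (hL Y₀ hY₀) = p s ⟨Y₀, hY₀⟩ := hm ⟨Y₀, hY₀⟩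
    refine (cancel_mono L.arrow).1 ?_
    rw [L.factorThru_arrow, ← hm, Category.assoc, Subobject.ofLE_arrow]

end Lattice

lemma isChainColimit_empty {A : Type u} [Category.{v} A] [Abelian A] (X : A) :
    IsChainColimit (∅ : Set (Subobject X)) ⊥ := by
  have hz : IsZero ((⊥ : Subobject X) : A) :=
    (isZero_zero A).of_iso Subobject.botCoeIsoZero
  exact ⟨by simp, ⟨{ desc := fun _ => 0
                     fac := fun _ Y => Y.2.elim
                     uniq := fun _ _ _ => hz.eq_of_src _ _ }⟩⟩

variable {k : Type u} [Field k] {X : IT k} {Δ : Set (Subobject X)}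

/-! ### Extending cocones to the right continuous hull -/

section Colimit

variable {C : Subobject X} (hC : ∀ Y ∈ Δ, Y ≤ C) (s : Cocone (chainDiagram Δ))

/-- The component at `x` of a leg of a cocone on a chain of subobjects. -/
def leg (Y : Δ) (x : ℝ) : (Y.1 : IT k).obj.obj x →ₗ[k] s.pt.obj.obj x :=
  cmp (s.ι.app Y : (Y.1 : IT k) ⟶ s.pt).hom x

/-- The component at `x` of the inclusion of a member of a chain into an upper bound. -/
def inc (Y : Δ) (x : ℝ) : (Y.1 : IT k).obj.obj x →ₗ[k] (C : IT k).obj.obj x :=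
  cmp (Subobject.ofLE Y.1 C (hC Y.1 Y.2)).hom x

/-- The partial map from an upper bound of a chain to the vertex of a cocone, defined at `x` on the
elements coming from the chain. -/
def Val (x : ℝ) (c : (C : IT k).obj.obj x) (t : s.pt.obj.obj x) : Prop :=
  ∃ (Y : Δ) (v : (Y.1 : IT k).obj.obj x), inc hC Y x v = c ∧ leg s Y x v = t

variable {hC s}

lemma inc_injective (Y : Δ) (x : ℝ) : Function.Injective (inc hC Y x) :=
  injective_cmp_of_mono (Subobject.ofLE Y.1 C (hC Y.1 Y.2)) x

lemma Val.tr {x y : ℝ} (h : x ≤ y) {c : (C : IT k).obj.obj x} {t : s.pt.obj.obj x}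
    (H : Val hC s x c t) : Val hC s y (JHS.tr _ h c) (JHS.tr _ h t) := by
  obtain ⟨Y, v, rfl, rfl⟩ := H
  exact ⟨Y, JHS.tr _ h v, cmp_tr _ _ _, cmp_tr _ _ _⟩

lemma exists_transport {Y Z : Δ} (h : Y.1 ≤ Z.1) (x : ℝ) (v : (Y.1 : IT k).obj.obj x) :
    ∃ w : (Z.1 : IT k).obj.obj x, inc hC Z x w = inc hC Y x v ∧ leg s Z x w = leg s Y x v := by
  refine ⟨cmp (Subobject.ofLE Y.1 Z.1 h).hom x v, ?_, ?_⟩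
  · exact congrArg (fun f : (Y.1 : IT k) ⟶ C => cmp f.hom x v)
      (Subobject.ofLE_comp_ofLE Y.1 Z.1 C h (hC Z.1 Z.2))
  · exact congrArg (fun f : (Y.1 : IT k) ⟶ s.pt => cmp f.hom x v)
      (s.w (homOfLE h : Y ⟶ Z))

lemma Val.exists_common (hΔ : IsPreSubobjectChain Δ) {x : ℝ} {c c' : (C : IT k).obj.obj x}
    {t t' : s.pt.obj.obj x} (H : Val hC s x c t) (H' : Val hC s x c' t') :
    ∃ (Y : Δ) (v v' : (Y.1 : IT k).obj.obj x), (inc hC Y x v = c ∧ leg s Y x v = t) ∧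
      (inc hC Y x v' = c' ∧ leg s Y x v' = t') := by
  obtain ⟨Y, v, rfl, rfl⟩ := H
  obtain ⟨Y', v', rfl, rfl⟩ := H'
  rcases hΔ.total Y.2 Y'.2 with h | h
  · obtain ⟨w, hw⟩ := exists_transport (hC := hC) (s := s) h x v
    exact ⟨Y', w, v', hw, rfl, rfl⟩
  · obtain ⟨w, hw⟩ := exists_transport (hC := hC) (s := s) h x v'
    exact ⟨Y, v, w, ⟨rfl, rfl⟩, hw⟩

lemma Val.unique (hΔ : IsPreSubobjectChain Δ) {x : ℝ} {c : (C : IT k).obj.obj x}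
    {t t' : s.pt.obj.obj x} (H : Val hC s x c t) (H' : Val hC s x c t') : t = t' := by
  obtain ⟨Y, v, v', ⟨h1, rfl⟩, ⟨h2, rfl⟩⟩ := H.exists_common hΔ H'
  rw [inc_injective Y x (h1.trans h2.symm)]

lemma Val.add (hΔ : IsPreSubobjectChain Δ) {x : ℝ} {c c' : (C : IT k).obj.obj x}
    {t t' : s.pt.obj.obj x} (H : Val hC s x c t) (H' : Val hC s x c' t') :
    Val hC s x (c + c') (t + t') := by
  obtain ⟨Y, v, v', ⟨rfl, rfl⟩, ⟨rfl, rfl⟩⟩ := H.exists_common hΔ H'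
  exact ⟨Y, v + v', map_add _ _ _, map_add _ _ _⟩

lemma Val.smul (a : k) {x : ℝ} {c : (C : IT k).obj.obj x} {t : s.pt.obj.obj x}
    (H : Val hC s x c t) : Val hC s x (a • c) (a • t) := by
  obtain ⟨Y, v, rfl, rfl⟩ := H
  exact ⟨Y, a • v, map_smul _ _ _, map_smul _ _ _⟩

variable (hC s) in
/-- The right continuous extension of `Val`. -/
def ExtVal (x : ℝ) (c : (C : IT k).obj.obj x) (t : s.pt.obj.obj x) : Prop :=
  ∀ (y : ℝ) (h : x < y), Val hC s y (tr _ h.le c) (tr _ h.le t)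

lemma ExtVal.unique (hΔ : IsPreSubobjectChain Δ) {x : ℝ} {c : (C : IT k).obj.obj x}
    {t t' : s.pt.obj.obj x} (H : ExtVal hC s x c t) (H' : ExtVal hC s x c t') : t = t' :=
  eq_of_tr_eq s.pt.property fun y hy => (H y hy).unique hΔ (H' y hy)

lemma exists_extVal (hΔ : IsPreSubobjectChain Δ)
    (hull : ∀ (x y : ℝ) (h : x < y) (c : (C : IT k).obj.obj x), ∃ (Y : Δ) (v : _),
      inc hC Y y v = tr _ h.le c) (x : ℝ) (c : (C : IT k).obj.obj x) :
    ∃ t, ExtVal hC s x c t := by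
  -- The value is read off at a `y` near `x`, where `c` already lies in the chain, and pulled back
  -- along an isomorphism of the target. Between `x` and `y`, any other candidate agrees with it at
  -- `y`.
  obtain ⟨b, hb, H⟩ := exists_bijective_tr s.pt.property x
  obtain ⟨y, hxy, hyb⟩ := exists_between hb
  obtain ⟨Y, v, hv⟩ := hull x y hxy c
  obtain ⟨t, ht⟩ := (H y hxy.le hyb).2 (leg s Y y v)
  have hVal : Val hC s y (tr _ hxy.le c) (tr _ hxy.le t) := ⟨Y, v, hv, ht.symm⟩
  refine ⟨t, fun z hxz => ?_⟩
  rcases le_total y z with hyz | hzy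
  · have := hVal.tr hyz
    rwa [tr_tr, tr_tr] at this
  · obtain ⟨Z, w, hw⟩ := hull x z hxz c
    obtain ⟨t', ht'⟩ := (H z hxz.le (hzy.trans_lt hyb)).2 (leg s Z z w)
    have hz : Val hC s z (tr _ hxz.le c) (tr _ hxz.le t') := ⟨Z, w, hw, ht'.symm⟩
    have := hz.tr hzy
    rw [tr_tr, tr_tr] at this
    rwa [(H y hxy.le hyb).1 (this.unique hΔ hVal)] at hz

/-- The hypothesis `hull` says that elements of `C` enter the chain once moved right. Right
continuity of the cocone vertex then determines a map on all of `C`; linearity and naturality follow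
from uniqueness of values. -/
lemma isChainColimit_of_hull (hΔ : IsPreSubobjectChain Δ) (hC : ∀ Y ∈ Δ, Y ≤ C)
    (hull : ∀ (x y : ℝ) (h : x < y) (c : (C : IT k).obj.obj x), ∃ (Y : Δ) (v : _),
      inc hC Y y v = tr _ h.le c) : IsChainColimit Δ C := by
  choose φ hφ using fun (s : Cocone (chainDiagram Δ)) (x : ℝ) (c : (C : IT k).obj.obj x) =>
    exists_extVal (s := s) hΔ hull x c
  let f (s : Cocone (chainDiagram Δ)) (x : ℝ) : (C : IT k).obj.obj x →ₗ[k] s.pt.obj.obj x :=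
    { toFun := φ s x
      map_add' := fun c c' => (hφ s x _).unique hΔ fun y h => by
        rw [map_add, map_add]
        exact (hφ s x c y h).add hΔ (hφ s x c' y h)
      map_smul' := fun a c => (hφ s x _).unique hΔ fun y h => by
        rw [map_smul, map_smul]
        exact (hφ s x c y h).smul a }
  have hf (s : Cocone (chainDiagram Δ)) (x y : ℝ) (h : x ≤ y) (c : (C : IT k).obj.obj x) :
      f s y (tr _ h c) = tr _ h (f s x c) := (hφ s y _).unique hΔ fun z hz => by
    rw [tr_tr, tr_tr]
    exact hφ s x c z (h.trans_lt hz)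
  refine ⟨hC, ⟨{
    desc := fun s => ObjectProperty.homMk (natMk (f s) (hf s))
    fac := fun s Y => ?_
    uniq := fun s m hm => ?_ }⟩⟩
  · refine hom_ext_cmp (T := (Y.1 : IT k)) fun x v => (hφ s x (inc hC Y x v)).unique hΔ fun y h => ?_
    exact Val.tr (hC := hC) (s := s) h.le ⟨Y, v, rfl, rfl⟩
  · refine hom_ext_cmp (T := (C : IT k)) fun x c =>
      ExtVal.unique hΔ (fun y h => ?_) (hφ s x c)
    obtain ⟨Y, v, hv⟩ := hull x y h c
    refine ⟨Y, v, hv, ?_⟩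
    rw [← cmp_tr, ← hv]
    exact congrArg (fun g : (Y.1 : IT k) ⟶ s.pt => cmp g.hom y v) (hm Y).symm

end Colimit

/-! ### The weakly JHS property, simple objects and maximal chains -/

lemma exists_isChainColimit (hΔ : IsPreSubobjectChain Δ) : ∃ C, IsChainColimit Δ C := by
  rcases Δ.eq_empty_or_nonempty with rfl | hne
  · exact ⟨⊥, isChainColimit_empty X⟩
  have hC := (isLUB_hullSub Δ).1
  refine ⟨(hullSub Δ).toSubobject, isChainColimit_of_hull hΔ hC fun x y h c => ?_⟩
  have hc : cmp (hullSub Δ).toSubobject.arrow.hom x c ∈ (hullSub Δ).carrier x := by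
    rw [← fib_toSubobject]
    exact ⟨c, rfl⟩
  obtain ⟨Y, hY, v, hv⟩ := exists_mem_of_mem_iSup_fib hΔ hne (mem_hullSub.1 hc y h)
  refine ⟨⟨Y, hY⟩, v, injective_cmp_of_mono (hullSub Δ).toSubobject.arrow y ?_⟩
  rw [cmp_tr, ← hv]
  exact congrArg (fun g : (Y : IT k) ⟶ X => cmp g.hom y v) (Subobject.ofLE_arrow (hC hY))

lemma exists_isChainLimit (hΔ : IsPreSubobjectChain Δ) (hne : Δ.Nonempty) :
    ∃ L, IsChainLimit Δ L := by
  refine ⟨(interSub Δ).toSubobject, isChainLimit_of_factors hΔ hne (isGLB_interSub Δ).1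
    fun T f hf => ?_⟩
  rw [ClosedSub.factors_toSubobject_iff]
  exact fun x m => mem_interSub.2 fun Y hY => (factors_iff_mem_fib Y f).1 (hf Y hY) x m

/-- A colimit exists and is a supremum, so uniqueness of suprema identifies it with `C`. Thus the
axioms can be checked in the lattice. -/
lemma isChainColimit_of_isLUB (hΔ : IsPreSubobjectChain Δ) {C : Subobject X} (h : IsLUB Δ C) :
    IsChainColimit Δ C := by
  obtain ⟨D, hD⟩ := exists_isChainColimit hΔ
  rwa [h.unique hD.isLUB]

lemma isChainLimit_of_isGLB (hΔ : IsPreSubobjectChain Δ) (hne : Δ.Nonempty) {L : Subobject X}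
    (h : IsGLB Δ L) : IsChainLimit Δ L := by
  obtain ⟨D, hD⟩ := exists_isChainLimit hΔ hne
  rwa [h.unique (hD.isGLB hne)]

theorem isWeaklyJHS (X : IT k) : IsWeaklyJHS X where
  cocomplete _ hΔ := exists_isChainColimit hΔ
  colim_inter _ Z _ hΔ hC := isChainColimit_of_isLUB
    (Monotone.isChain_image (f := fun Y => Y ⊓ Z) (fun _ _ h => inf_le_inf_right Z h) hΔ)
    (isLUB_image_inf hΔ hC.isLUB)
  complete _ hΔ hne := exists_isChainLimit hΔ hne
  lim_add _ Z _ hΔ hne hL := isChainLimit_of_isGLB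
    (Monotone.isChain_image (f := fun Y => Y ⊔ Z) (fun _ _ h => sup_le_sup_right h Z) hΔ)
    (hne.image _) (isGLB_image_sup hΔ hne (hL.isGLB hne))

theorem not_simple (X : IT k) : ¬ Simple X := by
  intro h
  obtain ⟨W, h1, h2⟩ := exists_between (bot_lt_top : (⊥ : Subobject X) < ⊤)
  rcases eq_bot_or_eq_top W with rfl | rfl
  · exact lt_irrefl _ h1
  · exact lt_irrefl _ h2

lemma mem_of_isMaxChain {α : Type*} [PartialOrder α] {Δ : Set α} (hΔ : IsMaxChain (· ≤ ·) Δ) {a : α}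
    (h : ∀ b ∈ Δ, a ≤ b ∨ b ≤ a) : a ∈ Δ := by
  rw [hΔ.2 (hΔ.1.insert fun b hb _ => h b hb) (Set.subset_insert a Δ)]
  exact Set.mem_insert a Δ

/-- An element strictly between `P` and `Y` is comparable with the whole chain, hence belongs to it
by maximality, contradicting that `P` bounds all members below `Y`. -/
lemma isEmpty_subfactorIndex (hΔ : IsMaxChain (· ≤ ·) Δ) : IsEmpty (SubfactorIndex Δ) := by
  refine ⟨fun ⟨⟨P, Y⟩, hY, hP, hlt⟩ => ?_⟩
  obtain ⟨W, h1, h2⟩ := exists_between hlt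
  have hub := (IsChainColimit.isLUB hP).1
  have hW : W ∈ Δ := mem_of_isMaxChain hΔ fun Z hZ => by
    rcases hΔ.1.total hY hZ with h | h
    · exact Or.inl (h2.le.trans h)
    · rcases h.eq_or_lt with rfl | h
      · exact Or.inl h2.le
      · exact Or.inr ((hub ⟨hZ, h⟩).trans h1.le)
  exact h1.not_ge (hub ⟨hW, h2⟩)

lemma isBicompleteChain_of_isMaxChain (hΔ : IsMaxChain (· ≤ ·) Δ) : IsBicompleteChain Δ where
  chain := hΔ.1
  bot_mem := hΔ.bot_mem
  top_mem := hΔ.top_mem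
  cocomplete Δ' h := by
    obtain ⟨C, hC⟩ := exists_isChainColimit (hΔ.1.mono h)
    refine ⟨C, mem_of_isMaxChain hΔ fun Z hZ => ?_, hC⟩
    by_cases hZ' : ∀ Y ∈ Δ', Y ≤ Z
    · exact Or.inl (hC.isLUB.2 hZ')
    · push Not at hZ'
      obtain ⟨Y, hY, hYZ⟩ := hZ'
      exact Or.inr (((hΔ.1.total (h hY) hZ).resolve_left hYZ).trans (hC.isLUB.1 hY))
  complete Δ' h hne := by
    obtain ⟨L, hL⟩ := exists_isChainLimit (hΔ.1.mono h) hne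
    refine ⟨L, mem_of_isMaxChain hΔ fun Z hZ => ?_, hL⟩
    by_cases hZ' : ∀ Y ∈ Δ', Z ≤ Y
    · exact Or.inr ((hL.isGLB hne).2 hZ')
    · push Not at hZ'
      obtain ⟨Y, hY, hYZ⟩ := hZ'
      exact Or.inl (((hL.isGLB hne).1 hY).trans ((hΔ.1.total hZ (h hY)).resolve_left hYZ))

theorem not_isJHS {X : IT k} (hX : ¬ IsZero X) : ¬ IsJHS X := by
  intro h
  obtain ⟨Δ, hΔ, -⟩ := IsChain.exists_maxChain (r := (· ≤ ·)) (c := (∅ : Set (Subobject X)))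
    Set.subsingleton_empty.isChain
  have he := isEmpty_subfactorIndex hΔ
  -- With no subfactors, their simplicity is vacuous.
  exact not_isEmpty_iff.2 (h.sf_nonempty hX Δ ⟨isBicompleteChain_of_isMaxChain hΔ, he.elim⟩) he

end JHS

end

theorem proposition5p11 (k : Type u) [Field k] :
    (∀ X : JHS.IT k, JHS.IsWeaklyJHS X) ∧
      (∀ X : JHS.IT k, ¬ Simple X) ∧
      (∀ X : JHS.IT k, ¬ IsZero X → ¬ JHS.IsJHS X) :=
  ⟨JHS.isWeaklyJHS, JHS.not_simple, fun _ => JHS.not_isJHS⟩
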